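/- For a matrix $M$ over a field and a real number $r\ge 0$, let $\mathsf r_M(r)$ (the regular rigidity of $M$ at rank $r$) be the smallest integer $s$ such that $M=A+B$, where $A$ has at most $s$ nonzero entries in each row and in each column and $B$ has rank at most $r$. Let $\mathrm{DFT}_N=\big(e^{2\pi i jk/N}\big)_{0\le j,k<N}$ be the $N\times N$ discrete Fourier transform matrix over $\mathbb C$. Fix a real constant $C_0$. For real $x>1$ call a prime $q$ *$x$-good* if $\frac{x}{(\log x)^{C_0}}\le q\le x$ and every prime power dividing $q-1$ is at most $x^{0.3}$, and call an integer *$(l,x)$-factorable* if it is a product of $l$ distinct $x$-good primes. **Theorem.** Let $C_0\in\mathbb R$ and $0<\epsilon<0.01$. There is $x_0=x_0(C_0,\epsilon)$ such that for every real $x\ge x_0$, every positive integer $l$ with $$\frac{x}{(\log x)^{C_0+100}}\le l\le \frac{x}{(\log x)^{C_0+10}},$$ and every $(l,x)$-factorable integer $N$, $$\mathsf r_{\mathrm{DFT}_N}\!\left(\frac{N}{\exp\left(\epsilon^6(\log N)^{0.36}\right)}\right)\le N^{7\epsilon}.$$ -/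

import Mathlib

namespace DFTRigidity

/-- `IsRegularSplit M r s`: one can write `M = A + B` with at most `s` nonzero entries of `A` in
each row and in each column, and `B` of rank at most `r`. -/
def IsRegularSplit {m n F : Type*} [Fintype n] [Field F]
    (M : Matrix m n F) (r : ℝ) (s : ℕ) : Prop :=
  ∃ A B : Matrix m n F, M = A + B ∧
    (∀ i, {j | A i j ≠ 0}.ncard ≤ s) ∧
    (∀ j, {i | A i j ≠ 0}.ncard ≤ s) ∧
    (B.rank : ℝ) ≤ r

/-- The regular rigidity `r_M(r)`: the smallest `s` such that `M = A + B` with at most `s` nonzero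
entries of `A` in each row and column and `rank B ≤ r`.  For `0 ≤ r` the set of such `s` is
nonempty (take `B = 0`), so that the infimum is a minimum. -/
noncomputable def regularRigidity {m n F : Type*} [Fintype n] [Field F]
    (M : Matrix m n F) (r : ℝ) : ℕ :=
  sInf {s : ℕ | IsRegularSplit M r s}

/-- The infimum defining the regular rigidity is attained. -/
theorem isRegularSplit_regularRigidity {m n F : Type*} [Fintype m] [Fintype n] [Field F]
    (M : Matrix m n F) {r : ℝ} (hr : 0 ≤ r) : IsRegularSplit M r (regularRigidity M r) := by
  have hne : {s : ℕ | IsRegularSplit M r s}.Nonempty := by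
    refine ⟨Nat.card m + Nat.card n, M, 0, by simp, fun i => ?_, fun j => ?_, by simpa using hr⟩
    · exact (Set.ncard_le_card _).trans (Nat.le_add_left _ _)
    · exact (Set.ncard_le_card _).trans (Nat.le_add_right _ _)
  exact Nat.sInf_mem hne

/-- The `N × N` discrete Fourier transform matrix, the character table of `ℤ/N`: rows are indexed
by the residues `j`, columns by the characters `j ↦ exp (2 π i j k / N)`, with `0 ≤ j, k < N`. -/
noncomputable def dftMatrix (N : ℕ) : Matrix (Fin N) (Fin N) ℂ :=
  fun j k => Complex.exp (2 * Real.pi * Complex.I * ((j : ℕ) : ℂ) * ((k : ℕ) : ℂ) / (N : ℂ))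

/-- `q` is an `(α, x)`-good prime, with respect to the constant `C₀`. -/
def IsGoodPrime (C₀ α x : ℝ) (q : ℕ) : Prop :=
  q.Prime ∧ x / Real.log x ^ C₀ ≤ (q : ℝ) ∧ (q : ℝ) ≤ x ∧
    ∀ t : ℕ, IsPrimePow t → t ∣ q - 1 → (t : ℝ) ≤ x ^ α

/-- `N` is `(l, α, x)`-factorable: a product of `l` distinct `(α, x)`-good primes. -/
def IsFactorable (C₀ : ℝ) (l : ℕ) (α x : ℝ) (N : ℕ) : Prop :=
  ∃ Q : Finset ℕ, Q.card = l ∧ (∀ q ∈ Q, IsGoodPrime C₀ α x q) ∧ N = ∏ q ∈ Q, q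

end DFTRigidity

namespace DFTRigidity

open Finset Matrix

/-! ### Splittings -/

/-! By the Chinese remainder theorem `DFT_N` is, up to permutations, a Kronecker product over the
primes `q ∣ N` of matrices `φ_q (x * y)` on `ZMod q`. On nonzero residues such a matrix is a group
matrix of the unit group, a product of cyclic groups of prime power order at most `x ^ 0.3`. The
character table `V` turns a group matrix into `V * diagonal g * Vᵀ`, and `V` is a Kronecker product
of Vandermonde matrices, each a product of two triangular ones (`exists_triangular_charTable`). The
residue 0 is restored by a simple matrix on either side (`zeroMatrix_conj`). So `DFT_N` is a product
of six Kronecker products: four triangular, two for the zeros.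

Each of these splits well (`isRegularSplit_of_weight`). In the triangular case an entry `(a, b)`
needs `b ≤ a` in every coordinate, while the centred coordinate sum of most points lies within `D`
of 0. Deleting the exceptional rows and columns costs little rank; in any other nonzero entry the
total drop from `a` to `b` is at most `2D`, so each row and column keeps few entries. The zero
factors work the same way, with the number of zero coordinates as the statistic. Exponential weights
make both the sparsity count and the tail bound multiplicative over coordinates.

With `n` primes and `L = log x`, taking `D = δ n L` gives tail exponent `δ² n L / x ^ 0.6`. This
exceeds `x ^ 0.38` because `n` is nearly `x`, whereas `(log N) ^ 0.36` is at most `x ^ 0.37`. -/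

theorem rank_matrix_add_le {m n F : Type*} [Fintype n] [Field F] [Fintype m] (A B : Matrix m n F) :
    (A + B).rank ≤ A.rank + B.rank := by
  have h1 : LinearMap.range (A + B).mulVecLin ≤
      LinearMap.range A.mulVecLin ⊔ LinearMap.range B.mulVecLin := by
    rintro _ ⟨v, rfl⟩
    rw [Matrix.mulVecLin_add, LinearMap.add_apply]
    exact Submodule.add_mem_sup ⟨v, rfl⟩ ⟨v, rfl⟩
  exact (Submodule.finrank_mono h1).trans (Submodule.finrank_add_le_finrank_add_finrank _ _)

theorem ncard_mul_support_le {m n p F : Type*} [Fintype n] [Fintype p] [Field F]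
    (A : Matrix m n F) (A' : Matrix n p F) {s s' : ℕ}
    (hA : ∀ i, {j | A i j ≠ 0}.ncard ≤ s) (hA' : ∀ i, {j | A' i j ≠ 0}.ncard ≤ s') (i : m) :
    {j | (A * A') i j ≠ 0}.ncard ≤ s * s' := by
  classical
  have hsub : {j | (A * A') i j ≠ 0} ⊆
      ((univ.filter fun k => A i k ≠ 0).biUnion fun k => univ.filter fun j => A' k j ≠ 0 :
        Finset p) := by
    intro j hj
    rw [Set.mem_ofPred_eq, Matrix.mul_apply] at hj
    obtain ⟨k, -, hk⟩ := Finset.exists_ne_zero_of_sum_ne_zero hj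
    simp only [coe_biUnion, Set.mem_iUnion, coe_filter, mem_univ, true_and, Set.mem_ofPred_eq]
    exact ⟨k, left_ne_zero_of_mul hk, right_ne_zero_of_mul hk⟩
  refine (Set.ncard_le_ncard hsub (Finset.finite_toSet _)).trans ?_
  rw [Set.ncard_coe_finset]
  have h1 : (univ.filter fun k => A i k ≠ 0).card ≤ s := by
    rw [← Set.ncard_coe_finset]; simpa using hA i
  refine (Finset.card_biUnion_le_card_mul _ _ s' fun k _ => ?_).trans (Nat.mul_le_mul_right _ h1)
  rw [← Set.ncard_coe_finset]; simpa using hA' k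

theorem IsRegularSplit.transpose {m n F : Type*} [Fintype m] [Fintype n] [Field F]
    {M : Matrix m n F} {r : ℝ} {s : ℕ} (h : IsRegularSplit M r s) : IsRegularSplit Mᵀ r s := by
  obtain ⟨A, B, rfl, h1, h2, h3⟩ := h
  exact ⟨Aᵀ, Bᵀ, Matrix.transpose_add _ _, h2, h1, by rwa [Matrix.rank_transpose]⟩

theorem IsRegularSplit.mul {m n p F : Type*} [Fintype m] [Fintype n] [Fintype p] [Field F]
    {M : Matrix m n F} {M' : Matrix n p F} {r r' : ℝ} {s s' : ℕ}
    (h : IsRegularSplit M r s) (h' : IsRegularSplit M' r' s') :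
    IsRegularSplit (M * M') (r + r') (s * s') := by
  obtain ⟨A, B, rfl, h1, h2, h3⟩ := h
  obtain ⟨A', B', rfl, h1', h2', h3'⟩ := h'
  -- Keeping `A' + B'` together leaves only two low-rank terms, one containing `B` and one
  -- containing `B'`, so the ranks simply add.
  refine ⟨A * A', B * (A' + B') + A * B', ?_, ncard_mul_support_le A A' h1 h1', fun j => ?_, ?_⟩
  · rw [Matrix.add_mul, Matrix.mul_add A]; abel
  · have := ncard_mul_support_le A'ᵀ Aᵀ h2' h2 j
    rw [← Matrix.transpose_mul, mul_comm] at this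
    exact this
  · have h4 : (B * (A' + B') + A * B').rank ≤ B.rank + B'.rank :=
      (rank_matrix_add_le _ _).trans
        (add_le_add (Matrix.rank_mul_le_left _ _) (Matrix.rank_mul_le_right _ _))
    have h5 : ((B * (A' + B') + A * B').rank : ℝ) ≤ B.rank + B'.rank := by exact_mod_cast h4
    linarith

theorem IsRegularSplit.mono {m n F : Type*} [Fintype n] [Field F]
    {M : Matrix m n F} {r r' : ℝ} {s : ℕ} (h : IsRegularSplit M r s) (hr : r ≤ r') :
    IsRegularSplit M r' s := by
  obtain ⟨A, B, h0, h1, h2, h3⟩ := h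
  exact ⟨A, B, h0, h1, h2, h3.trans hr⟩

theorem IsRegularSplit.submatrix {m n m' n' F : Type*} [Fintype n] [Fintype n'] [Field F]
    {M : Matrix m n F} {r : ℝ} {s : ℕ} (h : IsRegularSplit M r s) (e : m' ≃ m) (e' : n' ≃ n) :
    IsRegularSplit (M.submatrix e e') r s := by
  obtain ⟨A, B, rfl, h1, h2, h3⟩ := h
  refine ⟨A.submatrix e e', B.submatrix e e', rfl, fun i => ?_, fun j => ?_, ?_⟩
  · refine le_trans (le_of_eq ?_) (h1 (e i))
    exact Set.ncard_preimage_of_injective_subset_range (s := {j | A (e i) j ≠ 0})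
      e'.injective (by simp)
  · refine le_trans (le_of_eq ?_) (h2 (e' j))
    exact Set.ncard_preimage_of_injective_subset_range (s := {i | A i (e' j) ≠ 0})
      e.injective (by simp)
  · rwa [Matrix.rank_submatrix]

/-! ### Weights adapted to a relation -/

open scoped Classical in
/-- Row and column sums over the relation `R` of `exp (lam * (h y - h x))` are at most `c`. -/
def SparseWeight {X : Type*} [Fintype X] (R : X → X → Prop) (h : X → ℝ) (lam c : ℝ) : Prop :=
  (∀ x, ∑ y, (if R x y then Real.exp (lam * (h y - h x)) else 0) ≤ c) ∧
    ∀ y, ∑ x, (if R x y then Real.exp (lam * (h y - h x)) else 0) ≤ c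

/-- The exponential moments of `± h` at `mu`, under the uniform measure, are at most `b`. -/
def MomentBound {X : Type*} [Fintype X] (h : X → ℝ) (mu b : ℝ) : Prop :=
  ∑ x, Real.exp (mu * h x) ≤ Fintype.card X * b ∧
    ∑ x, Real.exp (-(mu * h x)) ≤ Fintype.card X * b

/-- Markov's inequality for the exponential moment. -/
theorem card_lt_le_of_sum_exp_le {X : Type*} [Fintype X] (h : X → ℝ) {mu K D : ℝ} (hmu : 0 ≤ mu)
    (hK : ∑ x, Real.exp (mu * h x) ≤ K) :
    ((univ.filter fun x => D < h x).card : ℝ) ≤ K * Real.exp (-(mu * D)) := by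
  have h1 : ((univ.filter fun x => D < h x).card : ℝ) * Real.exp (mu * D) ≤ K := by
    refine le_trans ?_ hK
    rw [← nsmul_eq_mul]
    refine (Finset.card_nsmul_le_sum (univ.filter fun x => D < h x)
      (fun x => Real.exp (mu * h x)) _ fun x hx => ?_).trans
      (Finset.sum_le_sum_of_subset_of_nonneg (filter_subset _ _)
        fun x _ _ => (Real.exp_pos _).le)
    exact Real.exp_le_exp.2 (mul_le_mul_of_nonneg_left (mem_filter.1 hx).2.le hmu)
  rw [Real.exp_neg, ← div_eq_mul_inv, le_div_iff₀ (Real.exp_pos _)]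
  exact h1

theorem card_le_floor_of_sum_le {X : Type*} [Fintype X] {p : X → Prop} {w : X → ℝ} {lam D c : ℝ}
    {S : Set X} (hS : ∀ y ∈ S, p y ∧ -(2 * lam * D) ≤ w y) [DecidablePred p]
    (hc : ∑ y, (if p y then Real.exp (w y) else 0) ≤ c) :
    S.ncard ≤ ⌊Real.exp (2 * lam * D) * c⌋₊ := by
  classical
  apply Nat.le_floor
  have h1 : (S.ncard : ℝ) * Real.exp (-(2 * lam * D)) ≤ c := by
    refine le_trans ?_ hc
    rw [Set.ncard_eq_toFinset_card', ← nsmul_eq_mul]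
    refine (Finset.card_nsmul_le_sum S.toFinset
      (fun y => if p y then Real.exp (w y) else 0) _ fun y hy => ?_).trans
      (Finset.sum_le_sum_of_subset_of_nonneg (subset_univ _) fun y _ _ => ?_)
    · obtain ⟨h1, h2⟩ := hS y (by simpa using hy)
      rw [if_pos h1]
      exact Real.exp_le_exp.2 h2
    · split_ifs
      · exact (Real.exp_pos _).le
      · exact le_rfl
  rw [Real.exp_neg, ← div_eq_mul_inv, div_le_iff₀ (Real.exp_pos _)] at h1
  linarith

/-- A matrix supported on a relation with a sparse, concentrated weight becomes sparse after
deleting the rows of large weight and the columns of small weight. -/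
theorem isRegularSplit_of_weight {X F : Type*} [Fintype X] [Field F] {T : Matrix X X F}
    {R : X → X → Prop} (hT : ∀ x y, T x y ≠ 0 → R x y) {h : X → ℝ} {lam mu c b D : ℝ}
    (hlam : 0 ≤ lam) (hmu : 0 ≤ mu) (hR : SparseWeight R h lam c) (hb : MomentBound h mu b) :
    IsRegularSplit T (2 * (Fintype.card X * b * Real.exp (-(mu * D))))
      ⌊Real.exp (2 * lam * D) * c⌋₊ := by
  classical
  -- Heavy rows go to `B`, light columns to `B'`. An entry that remains has `h y - h x ≥ -2D`, so it
  -- contributes at least `exp (-2 lam D)` to a weighted sum bounded by `c`.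
  set A : Matrix X X F := Matrix.of fun x y => if h x ≤ D ∧ -D ≤ h y then T x y else 0 with hA
  set B : Matrix X X F := Matrix.of fun x y => if D < h x then T x y else 0 with hB
  set B' : Matrix X X F := Matrix.of fun x y => if h x ≤ D ∧ h y < -D then T x y else 0 with hB'
  have key : ∀ x y, A x y ≠ 0 → R x y ∧ -(2 * lam * D) ≤ lam * (h y - h x) := by
    intro x y hxy
    rw [hA, Matrix.of_apply] at hxy
    split_ifs at hxy with h1
    · exact ⟨hT _ _ hxy, by nlinarith⟩
    · exact absurd rfl hxy
  refine ⟨A, B + B', ?_, fun x => ?_, fun y => ?_, ?_⟩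
  · ext x y
    simp only [hA, hB, hB', Matrix.add_apply, Matrix.of_apply]
    by_cases h1 : h x ≤ D <;> by_cases h2 : -D ≤ h y <;>
      simp [h1, h2, not_lt.2, lt_of_not_ge]
  · exact card_le_floor_of_sum_le (p := R x) (w := fun y => lam * (h y - h x))
      (fun y hy => key x y hy) (hR.1 x)
  · exact card_le_floor_of_sum_le (p := fun x => R x y) (w := fun x => lam * (h y - h x))
      (fun x hx => key x y hx) (hR.2 y)
  · have e1 := card_lt_le_of_sum_exp_le h (D := D) hmu hb.1
    have e2 := card_lt_le_of_sum_exp_le (fun x => -h x) (D := D) hmu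
      (by simpa only [mul_neg] using hb.2)
    have r1 : B.rank ≤ (univ.filter fun x => D < h x).card := by
      refine Matrix.rank_le_card_of_support_subset _ _ fun x hx => ?_
      by_contra hx'
      refine hx (funext fun y => if_neg ?_)
      simpa using hx'
    have r2 : B'.rank ≤ (univ.filter fun x => D < -h x).card := by
      rw [← Matrix.rank_transpose]
      refine Matrix.rank_le_card_of_support_subset _ _ fun x hx => ?_
      by_contra hx'
      refine hx (funext fun y => if_neg ?_)
      have h3 : -D ≤ h x := by
        have : ¬ D < -h x := by simpa using hx'
        linarith
      exact fun h4 => absurd h4.2 (not_lt.2 h3)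
    have r5 := (Nat.cast_le (α := ℝ)).2 ((rank_matrix_add_le B B').trans (add_le_add r1 r2))
    push_cast at r5
    linarith

/-- For an additive weight and a coordinatewise relation the summand is a product over coordinates,
so the sum over the product space factors. -/
theorem SparseWeight.pi {ι : Type*} [Fintype ι] [DecidableEq ι] {X : ι → Type*}
    [∀ i, Fintype (X i)]
    {R : ∀ i, X i → X i → Prop} {h : ∀ i, X i → ℝ} {lam : ℝ} {c : ι → ℝ}
    (hR : ∀ i, SparseWeight (R i) (h i) lam (c i)) :
    SparseWeight (fun x y : ∀ i, X i => ∀ i, R i (x i) (y i)) (fun x => ∑ i, h i (x i)) lam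
      (∏ i, c i) := by
  classical
  have key : ∀ (x y : ∀ i, X i) (hd : Decidable (∀ i, R i (x i) (y i))),
      @ite ℝ (∀ i, R i (x i) (y i)) hd
        (Real.exp (lam * (∑ i, h i (y i) - ∑ i, h i (x i)))) 0 =
      ∏ i, (if R i (x i) (y i) then Real.exp (lam * (h i (y i) - h i (x i))) else 0) := by
    intro x y hd
    by_cases hxy : ∀ i, R i (x i) (y i)
    · rw [if_pos hxy, ← Finset.sum_sub_distrib, Finset.mul_sum, Real.exp_sum]
      exact Finset.prod_congr rfl fun i _ => (if_pos (hxy i)).symm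
    · rw [if_neg hxy]
      push Not at hxy
      obtain ⟨i, hi⟩ := hxy
      exact (Finset.prod_eq_zero (mem_univ i) (if_neg hi)).symm
  have nn : ∀ (i) (x y : X i), 0 ≤ (if R i x y then Real.exp (lam * (h i y - h i x)) else 0) := by
    intro i x y
    split_ifs
    · exact (Real.exp_pos _).le
    · exact le_rfl
  constructor
  · intro x
    refine le_trans (le_of_eq ?_) (Finset.prod_le_prod
      (fun i _ => Finset.sum_nonneg fun y _ => nn i (x i) y) fun i _ => (hR i).1 (x i))
    rw [Fintype.prod_sum]
    exact Finset.sum_congr rfl fun y _ => key x y _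
  · intro y
    refine le_trans (le_of_eq ?_) (Finset.prod_le_prod
      (fun i _ => Finset.sum_nonneg fun x _ => nn i x (y i)) fun i _ => (hR i).2 (y i))
    rw [Fintype.prod_sum]
    exact Finset.sum_congr rfl fun x _ => key x y _

theorem MomentBound.pi {ι : Type*} [Fintype ι] [DecidableEq ι] {X : ι → Type*}
    [∀ i, Fintype (X i)] {h : ∀ i, X i → ℝ} {mu : ℝ} {b : ι → ℝ}
    (hb : ∀ i, MomentBound (h i) mu (b i)) :
    MomentBound (fun x : ∀ i, X i => ∑ i, h i (x i)) mu (∏ i, b i) := by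
  have aux : ∀ t : ℝ, (∀ i, ∑ x, Real.exp (t * h i x) ≤ Fintype.card (X i) * b i) →
      ∑ x : ∀ i, X i, Real.exp (t * ∑ i, h i (x i)) ≤ Fintype.card (∀ i, X i) * ∏ i, b i := by
    intro t ht
    rw [Fintype.card_pi, Nat.cast_prod, ← Finset.prod_mul_distrib]
    refine le_trans (le_of_eq ?_) (Finset.prod_le_prod
      (fun i _ => Finset.sum_nonneg fun x _ => (Real.exp_pos (t * h i x)).le) fun i _ => ht i)
    rw [Fintype.prod_sum]
    refine Finset.sum_congr rfl fun x _ => ?_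
    rw [Finset.mul_sum, Real.exp_sum]
  refine ⟨aux mu fun i => (hb i).1, ?_⟩
  have := aux (-mu) fun i => by simpa only [neg_mul] using (hb i).2
  simpa only [neg_mul] using this

/-! ### Kronecker products of families -/

/-- The Kronecker product of a finite family of matrices. -/
def kron {ι F : Type*} [Fintype ι] [CommRing F] {X Y : ι → Type*}
    (M : ∀ i, Matrix (X i) (Y i) F) : Matrix (∀ i, X i) (∀ i, Y i) F :=
  Matrix.of fun x y => ∏ i, M i (x i) (y i)

section kron

variable {ι F : Type*} [Fintype ι] [CommRing F] {X Y Z : ι → Type*}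

theorem kron_transpose (M : ∀ i, Matrix (X i) (Y i) F) :
    (kron M)ᵀ = kron fun i => (M i)ᵀ := rfl

theorem kron_mul [DecidableEq ι] [∀ i, Fintype (Y i)] (M : ∀ i, Matrix (X i) (Y i) F)
    (M' : ∀ i, Matrix (Y i) (Z i) F) : kron M * kron M' = kron fun i => M i * M' i := by
  ext x z
  simp only [kron, Matrix.mul_apply, Matrix.of_apply]
  rw [Fintype.prod_sum]
  exact Finset.sum_congr rfl fun y _ => Finset.prod_mul_distrib.symm

theorem kron_one [∀ i, DecidableEq (X i)] [DecidableEq (∀ i, X i)] :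
    kron (fun i => (1 : Matrix (X i) (X i) F)) = 1 := by
  ext x y
  by_cases hxy : x = y
  · subst hxy; simp [kron]
  · rw [Matrix.one_apply_ne hxy]
    obtain ⟨i, hi⟩ := Function.ne_iff.1 hxy
    exact Finset.prod_eq_zero (mem_univ i) (Matrix.one_apply_ne hi)

theorem kron_support {M : ∀ i, Matrix (X i) (Y i) F} {R : ∀ i, X i → Y i → Prop}
    (hM : ∀ i x y, M i x y ≠ 0 → R i x y) (x : ∀ i, X i) (y : ∀ i, Y i) (h : kron M x y ≠ 0)
    (i : ι) : R i (x i) (y i) := by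
  refine hM i _ _ fun h0 => h ?_
  exact Finset.prod_eq_zero (mem_univ i) h0

end kron

/-! ### Triangular supports on products of cyclic groups -/

/-- The relation `b ≤ a` on representatives in `[0, d)`. -/
def valRel (d : ℕ) (a b : ZMod d) : Prop := b.val ≤ a.val

/-- The centred representative. -/
noncomputable def valWeight (d : ℕ) (a : ZMod d) : ℝ := a.val - ((d : ℝ) - 1) / 2

/-- Distinct exponents give at most a full geometric series, and `(1 - t) * (1 + 2 * t) ≥ 1` for `0
≤ t ≤ 1 / 2`. -/
theorem sum_pow_le_of_injOn {α : Type*} (S : Finset α) (g : α → ℕ) (hg : Set.InjOn g S) {t : ℝ}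
    (h0 : 0 ≤ t) (h1 : t ≤ 1 / 2) : ∑ a ∈ S, t ^ g a ≤ Real.exp (2 * t) := by
  have e1 : ∑ a ∈ S, t ^ g a ≤ (1 - t)⁻¹ := by
    classical
    rw [← Finset.sum_image (f := fun n => t ^ n) hg,
      ← tsum_geometric_of_lt_one h0 (by linarith)]
    exact (summable_geometric_of_lt_one h0 (by linarith)).sum_le_tsum _
      fun n _ => pow_nonneg h0 n
  refine e1.trans ?_
  have e2 := Real.add_one_le_exp (2 * t)
  rw [inv_le_iff_one_le_mul₀' (by linarith)]
  nlinarith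

theorem sparseWeight_val (d : ℕ) [NeZero d] {lam : ℝ} (hlam : Real.exp (-lam) ≤ 1 / 2) :
    SparseWeight (valRel d) (valWeight d) lam (Real.exp (2 * Real.exp (-lam))) := by
  classical
  have key : ∀ a b : ZMod d, b.val ≤ a.val →
      Real.exp (lam * (valWeight d b - valWeight d a)) = Real.exp (-lam) ^ (a.val - b.val) := by
    intro a b hab
    rw [← Real.exp_nat_mul, Nat.cast_sub hab]
    congr 1
    simp only [valWeight]
    ring
  constructor
  · intro a
    rw [← Finset.sum_filter]
    refine le_trans (le_of_eq (Finset.sum_congr rfl fun b hb => key a b (mem_filter.1 hb).2))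
      (sum_pow_le_of_injOn _ (fun b : ZMod d => a.val - b.val) ?_ (Real.exp_pos _).le hlam)
    intro b hb b' hb' h
    have h1 : b.val ≤ a.val := (mem_filter.1 (mem_coe.1 hb)).2
    have h2 : b'.val ≤ a.val := (mem_filter.1 (mem_coe.1 hb')).2
    refine ZMod.val_injective d ?_
    simp only at h
    omega
  · intro b
    rw [← Finset.sum_filter]
    refine le_trans (le_of_eq (Finset.sum_congr rfl fun a ha => key a b (mem_filter.1 ha).2))
      (sum_pow_le_of_injOn _ (fun a : ZMod d => a.val - b.val) ?_ (Real.exp_pos _).le hlam)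
    intro a ha a' ha' h
    have h1 : b.val ≤ a.val := (mem_filter.1 (mem_coe.1 ha)).2
    have h2 : b.val ≤ a'.val := (mem_filter.1 (mem_coe.1 ha')).2
    refine ZMod.val_injective d ?_
    simp only at h
    omega

theorem sum_zmod_eq_sum_range {M : Type*} [AddCommMonoid M] (d : ℕ) [NeZero d] (f : ℕ → M) :
    ∑ a : ZMod d, f a.val = ∑ k ∈ range d, f k := by
  obtain ⟨n, rfl⟩ := Nat.exists_eq_succ_of_ne_zero (NeZero.ne d)
  exact Fin.sum_univ_eq_sum_range f (n + 1)

/-- The centred values are symmetric about 0, so the exponential may be replaced by `cosh`; then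
`cosh u ≤ exp (u ^ 2 / 2)` with `|u| ≤ |t| * d / 2`. -/
theorem momentBound_val (d : ℕ) [NeZero d] (mu : ℝ) :
    MomentBound (valWeight d) mu (Real.exp (mu ^ 2 * d ^ 2 / 8)) := by
  have aux : ∀ t : ℝ, ∑ a, Real.exp (t * valWeight d a) ≤
      Fintype.card (ZMod d) * Real.exp (t ^ 2 * d ^ 2 / 8) := by
    intro t
    rw [ZMod.card]
    simp only [valWeight]
    rw [sum_zmod_eq_sum_range d fun k => Real.exp (t * ((k : ℝ) - ((d : ℝ) - 1) / 2))]
    have h1 : ∑ k ∈ range d, Real.exp (t * ((k : ℝ) - ((d : ℝ) - 1) / 2)) =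
        ∑ k ∈ range d, Real.exp (-(t * ((k : ℝ) - ((d : ℝ) - 1) / 2))) := by
      rw [← Finset.sum_range_reflect]
      refine Finset.sum_congr rfl fun k hk => ?_
      have hk' : k < d := mem_range.1 hk
      rw [Nat.sub_sub, Nat.cast_sub (by omega)]
      congr 1
      push_cast
      ring
    have h2 : ∑ k ∈ range d, Real.exp (t * ((k : ℝ) - ((d : ℝ) - 1) / 2)) =
        ∑ k ∈ range d, Real.cosh (t * ((k : ℝ) - ((d : ℝ) - 1) / 2)) := by
      simp only [Real.cosh_eq]
      rw [← Finset.sum_div, Finset.sum_add_distrib, ← h1]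
      ring
    rw [h2]
    have h3 : ∀ k ∈ range d, Real.cosh (t * ((k : ℝ) - ((d : ℝ) - 1) / 2)) ≤
        Real.exp (t ^ 2 * d ^ 2 / 8) := by
      intro k hk
      refine (Real.cosh_le_exp_half_sq _).trans (Real.exp_le_exp.2 ?_)
      have hk' : (k : ℝ) + 1 ≤ d := by exact_mod_cast mem_range.1 hk
      have hk0 : (0 : ℝ) ≤ k := Nat.cast_nonneg k
      have h4 : ((k : ℝ) - ((d : ℝ) - 1) / 2) ^ 2 ≤ (d : ℝ) ^ 2 / 4 := by nlinarith
      have h5 := mul_le_mul_of_nonneg_left h4 (sq_nonneg t)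
      rw [mul_pow]
      linarith
    have := Finset.sum_le_card_nsmul _ _ _ h3
    simpa using this
  refine ⟨aux mu, ?_⟩
  have := aux (-mu)
  simpa only [neg_mul, neg_sq] using this

section pi

variable {J : Type*} [Fintype J] [DecidableEq J] (d : J → ℕ) [∀ j, NeZero (d j)]

/-- The coordinatewise relation `b ≤ a` on representatives. -/
def piValRel {J : Type*} (d : J → ℕ) (a b : ∀ j, ZMod (d j)) : Prop :=
  ∀ j, valRel (d j) (a j) (b j)

/-- The sum of the centred representatives. -/
noncomputable def piValWeight {J : Type*} [Fintype J] (d : J → ℕ) (a : ∀ j, ZMod (d j)) : ℝ :=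
  ∑ j, valWeight (d j) (a j)

theorem sparseWeight_piVal {lam : ℝ} (hlam : Real.exp (-lam) ≤ 1 / 2) :
    SparseWeight (piValRel d) (piValWeight d) lam
      (Real.exp (2 * Real.exp (-lam) * Fintype.card J)) := by
  have h := SparseWeight.pi fun j => sparseWeight_val (d j) hlam
  rw [Finset.prod_const, ← Real.exp_nat_mul, mul_comm, Finset.card_univ] at h
  exact h

theorem MomentBound.mono {X : Type*} [Fintype X] {h : X → ℝ} {mu b b' : ℝ}
    (H : MomentBound h mu b) (hb : b ≤ b') : MomentBound h mu b' :=
  ⟨H.1.trans (mul_le_mul_of_nonneg_left hb (Nat.cast_nonneg _)),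
    H.2.trans (mul_le_mul_of_nonneg_left hb (Nat.cast_nonneg _))⟩

theorem momentBound_piVal {D : ℝ} (hD : ∀ j, (d j : ℝ) ≤ D) (mu : ℝ) :
    MomentBound (piValWeight d) mu (Real.exp (Fintype.card J * (mu ^ 2 * D ^ 2 / 8))) := by
  have h := MomentBound.pi fun j => (momentBound_val (d j) mu).mono
    (b' := Real.exp (mu ^ 2 * D ^ 2 / 8)) (Real.exp_le_exp.2 (by
      have h1 : (d j : ℝ) ^ 2 ≤ D ^ 2 := pow_le_pow_left₀ (Nat.cast_nonneg _) (hD j) 2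
      have h2 := mul_le_mul_of_nonneg_left h1 (sq_nonneg mu)
      linarith))
  rw [Finset.prod_const, ← Real.exp_nat_mul, Finset.card_univ] at h
  exact h

end pi

/-! ### Factoring group matrices -/

/-- Coefficients of `z ^ j` in the Newton basis with nodes `v`. -/
def newtonCoeff {F : Type*} [CommRing F] (v : ℕ → F) : ℕ → ℕ → F
  | 0, 0 => 1
  | 0, _ + 1 => 0
  | j + 1, 0 => v 0 * newtonCoeff v j 0
  | j + 1, i + 1 => newtonCoeff v j i + v (i + 1) * newtonCoeff v j (i + 1)

theorem newtonCoeff_eq_zero {F : Type*} [CommRing F] (v : ℕ → F) :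
    ∀ j i, j < i → newtonCoeff v j i = 0
  | 0, 0, h => absurd h (lt_irrefl _)
  | 0, _ + 1, _ => rfl
  | j + 1, 0, h => absurd h (Nat.not_lt_zero _)
  | j + 1, i + 1, h => by
    rw [newtonCoeff, newtonCoeff_eq_zero v j i (by omega),
      newtonCoeff_eq_zero v j (i + 1) (by omega), mul_zero, add_zero]

/-- The recursion for the coefficients comes from multiplying a Newton basis polynomial by `z = (z -
v i) + v i`. -/
theorem pow_eq_sum_newtonCoeff {F : Type*} [CommRing F] (v : ℕ → F) (z : F) (j n : ℕ)
    (hn : j < n) : z ^ j = ∑ i ∈ range n, newtonCoeff v j i * ∏ k ∈ range i, (z - v k) := by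
  have h0 : ∀ j n, j < n → ∑ i ∈ range n, newtonCoeff v j i * ∏ k ∈ range i, (z - v k) =
      ∑ i ∈ range (j + 1), newtonCoeff v j i * ∏ k ∈ range i, (z - v k) := by
    intro j n hn
    refine (Finset.sum_subset (by simpa using hn) fun i _ hi => ?_).symm
    rw [newtonCoeff_eq_zero v j i (by simpa using hi), zero_mul]
  rw [h0 j n hn]
  clear hn
  induction j with
  | zero => simp [newtonCoeff]
  | succ j ih =>
    rw [Finset.sum_range_succ', pow_succ, ih, Finset.sum_mul]
    simp only [newtonCoeff, add_mul, Finset.sum_add_distrib]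
    have e1 : ∀ i, newtonCoeff v j i * (∏ k ∈ range i, (z - v k)) * z =
        newtonCoeff v j i * (∏ k ∈ range (i + 1), (z - v k)) +
          v i * newtonCoeff v j i * ∏ k ∈ range i, (z - v k) := by
      intro i
      rw [Finset.prod_range_succ]
      ring
    simp only [e1, Finset.sum_add_distrib, add_assoc]
    congr 1
    rw [← Finset.sum_range_succ' fun i => v i * newtonCoeff v j i * ∏ k ∈ range i, (z - v k),
      Finset.sum_range_succ _ (j + 1), newtonCoeff_eq_zero v j (j + 1) (by omega)]
    simp

section dft

variable (d : ℕ) [NeZero d]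

/-- The character table of `ZMod d`. -/
noncomputable def charTable (d : ℕ) [NeZero d] : Matrix (ZMod d) (ZMod d) ℂ :=
  Matrix.of fun a c => ZMod.stdAddChar a ^ c.val

theorem charTable_add (a b c : ZMod d) :
    charTable d (a + b) c = charTable d a c * charTable d b c := by
  simp only [charTable, Matrix.of_apply, AddChar.map_add_eq_mul, mul_pow]

theorem det_charTable_ne_zero : (charTable d).det ≠ 0 := by
  obtain ⟨n, rfl⟩ := Nat.exists_eq_succ_of_ne_zero (NeZero.ne d)
  exact Matrix.det_vandermonde_ne_zero_iff (n := n + 1) (v := fun a => ZMod.stdAddChar (N := n + 1) a)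
    |>.2 fun a b h => ZMod.injective_stdAddChar (N := n + 1) h

/-- Newton interpolation at the nodes themselves: the `i`-th basis polynomial vanishes at the first
`i` nodes, which makes `U` triangular, and expanding `z ^ c` involves only basis polynomials of
degree at most `c`, which makes `L` triangular. -/
theorem exists_triangular_charTable : ∃ U L : Matrix (ZMod d) (ZMod d) ℂ,
    (∀ a b, U a b ≠ 0 → valRel d a b) ∧ (∀ a b, L a b ≠ 0 → valRel d a b) ∧
      charTable d = U * Lᵀ := by
  let v : ℕ → ℂ := fun k => ZMod.stdAddChar (k : ZMod d)
  refine ⟨Matrix.of fun a i => ∏ k ∈ range i.val, (ZMod.stdAddChar a - v k),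
    Matrix.of fun c i => newtonCoeff v c.val i.val, fun a i h => ?_, fun c i h => ?_, ?_⟩
  · by_contra hlt
    refine h (Finset.prod_eq_zero (mem_range.2 (not_le.1 hlt)) ?_)
    simp [v]
  · by_contra hlt
    exact h (newtonCoeff_eq_zero v _ _ (not_le.1 hlt))
  · ext a c
    simp only [charTable, Matrix.mul_apply, Matrix.of_apply, Matrix.transpose_apply]
    rw [pow_eq_sum_newtonCoeff v _ c.val d (ZMod.val_lt c), ← sum_zmod_eq_sum_range]
    exact Finset.sum_congr rfl fun i _ => mul_comm _ _

end dft

/-- Every group matrix of `∏ ZMod (d j)` is a product of four matrices with triangular support. -/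
theorem exists_triangular_groupMatrix {J : Type*} [Fintype J] [DecidableEq J] (d : J → ℕ)
    [∀ j, NeZero (d j)] (f : (∀ j, ZMod (d j)) → ℂ) :
    ∃ U L L' : Matrix (∀ j, ZMod (d j)) (∀ j, ZMod (d j)) ℂ,
      (∀ a b, U a b ≠ 0 → piValRel d a b) ∧ (∀ a b, L a b ≠ 0 → piValRel d a b) ∧
      (∀ a b, L' a b ≠ 0 → piValRel d a b) ∧
      Matrix.of (fun a b => f (a + b)) = U * Lᵀ * L' * Uᵀ := by
  classical
  choose U L hU hL hUL using fun j => exists_triangular_charTable (d j)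
  set V := kron fun j => charTable (d j) with hV
  have hV' : V = kron U * (kron L)ᵀ := by
    rw [kron_transpose, kron_mul, hV]
    congr 1
    funext j
    exact hUL j
  have hinv : V * kron (fun j => (charTable (d j))⁻¹) = 1 := by
    rw [hV, kron_mul, ← kron_one]
    congr 1
    funext j
    exact Matrix.mul_nonsing_inv _ (isUnit_iff_ne_zero.2 (det_charTable_ne_zero (d j)))
  -- `g` holds the coefficients of `f` in the basis of characters. Multiplicativity of characters
  -- then gives `f (a + b) = ∑ c, g c * V a c * V b c`. The diagonal factor does not enlarge the
  -- support of `L`, so it is absorbed into `L'`.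
  set g := (kron (fun j => (charTable (d j))⁻¹)) *ᵥ f with hg
  have hf : V *ᵥ g = f := by rw [hg, Matrix.mulVec_mulVec, hinv, Matrix.one_mulVec]
  refine ⟨kron U, kron L, Matrix.diagonal g * kron L, fun a b h => kron_support hU a b h,
    fun a b h => kron_support hL a b h, fun a b h => kron_support hL a b ?_, ?_⟩
  · rw [Matrix.diagonal_mul] at h
    exact right_ne_zero_of_mul h
  · have h1 : kron U * (kron L)ᵀ * (Matrix.diagonal g * kron L) * (kron U)ᵀ =
        V * Matrix.diagonal g * Vᵀ := by
      rw [hV', Matrix.transpose_mul, Matrix.transpose_transpose]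
      simp only [Matrix.mul_assoc]
    rw [h1]
    ext a b
    rw [Matrix.of_apply, ← hf, Matrix.mul_apply, Matrix.mulVec, dotProduct]
    refine Finset.sum_congr rfl fun c _ => ?_
    rw [Matrix.mul_diagonal, Matrix.transpose_apply]
    have h2 : V (a + b) c = V a c * V b c := by
      simp only [hV, kron, Matrix.of_apply, Pi.add_apply, charTable_add, Finset.prod_mul_distrib]
    rw [h2]
    ring

/-! ### Adjoining a zero -/

section opt

variable {Y : Type*}

/-- The block matrix `1 ⊕ M`. -/
def optMatrix (M : Matrix Y Y ℂ) : Matrix (Option Y) (Option Y) ℂ :=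
  Matrix.of fun x y => x.elim (y.elim 1 fun _ => 0) fun a => y.elim 0 fun b => M a b

/-- The relation `R` extended by relating the new point to itself. -/
def optRel (R : Y → Y → Prop) (x y : Option Y) : Prop :=
  x.elim (y = none) fun a => ∃ b, y = some b ∧ R a b

/-- The weight `h`, extended by zero. -/
def optWeight (h : Y → ℝ) (x : Option Y) : ℝ := x.elim 0 h

@[simp]
theorem optRel_none_left (R : Y → Y → Prop) (y : Option Y) : optRel R none y ↔ y = none := Iff.rfl

@[simp]
theorem optRel_some_none (R : Y → Y → Prop) (a : Y) : ¬ optRel R (some a) none := by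
  simp [optRel]

@[simp]
theorem optRel_some_some (R : Y → Y → Prop) (a b : Y) : optRel R (some a) (some b) ↔ R a b := by
  simp [optRel]

theorem optMatrix_transpose (M : Matrix Y Y ℂ) : (optMatrix M)ᵀ = optMatrix Mᵀ := by
  ext x y
  cases x <;> cases y <;> rfl

theorem optMatrix_mul [Fintype Y] (M M' : Matrix Y Y ℂ) :
    optMatrix M * optMatrix M' = optMatrix (M * M') := by
  ext x y
  rw [Matrix.mul_apply, Fintype.sum_option]
  cases x <;> cases y <;> simp [optMatrix, Matrix.mul_apply]

theorem optMatrix_support {M : Matrix Y Y ℂ} {R : Y → Y → Prop} (hM : ∀ a b, M a b ≠ 0 → R a b)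
    (x y : Option Y) (h : optMatrix M x y ≠ 0) : optRel R x y := by
  cases x <;> cases y <;> simp_all [optMatrix]

theorem SparseWeight.opt [Fintype Y] {R : Y → Y → Prop} {h : Y → ℝ} {lam c : ℝ} (hc : 1 ≤ c)
    (hR : SparseWeight R h lam c) : SparseWeight (optRel R) (optWeight h) lam c := by
  classical
  constructor
  · rintro (_ | a) <;> rw [Fintype.sum_option]
    · simpa [optWeight] using hc
    · refine le_trans (le_of_eq ?_) (hR.1 a)
      rw [if_neg (optRel_some_none R a), zero_add]
      exact Finset.sum_congr rfl fun b _ => if_congr (optRel_some_some R a b) rfl rfl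
  · rintro (_ | a) <;> rw [Fintype.sum_option]
    · simpa [optWeight] using hc
    · refine le_trans (le_of_eq ?_) (hR.2 a)
      rw [if_neg (by simp), zero_add]
      exact Finset.sum_congr rfl fun b _ => if_congr (optRel_some_some R b a) rfl rfl

theorem MomentBound.opt [Fintype Y] {h : Y → ℝ} {mu b : ℝ} (hb : 1 ≤ b)
    (H : MomentBound h mu b) : MomentBound (optWeight h) mu b := by
  constructor <;> rw [Fintype.sum_option, Fintype.card_option]
  · have := H.1
    simp only [optWeight, Option.elim, mul_zero, Real.exp_zero]
    push_cast
    linarith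
  · have := H.2
    simp only [optWeight, Option.elim, mul_zero, neg_zero, Real.exp_zero]
    push_cast
    linarith

/-- The relation allowing a point to be sent to the zero. -/
def zeroRel (x y : Option Y) : Prop := y = none ∨ y = x

@[simp]
theorem zeroRel_none_right (x : Option Y) : zeroRel x none := Or.inl rfl

@[simp]
theorem zeroRel_some_right (x : Option Y) (a : Y) : zeroRel x (some a) ↔ some a = x := by
  simp [zeroRel]

/-- Minus the indicator function of the zero. -/
def zeroWeight (x : Option Y) : ℝ := x.elim (-1) fun _ => 0

open scoped Classical in
/-- The indicator matrix of `zeroRel`. -/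
noncomputable def zeroMatrix (Y : Type*) : Matrix (Option Y) (Option Y) ℂ :=
  Matrix.of fun x y => if zeroRel x y then 1 else 0

theorem zeroMatrix_support (x y : Option Y) (h : zeroMatrix Y x y ≠ 0) : zeroRel x y := by
  by_contra h0
  exact h (if_neg h0)

/-- The only crowded column is that of the zero; its weight `-1` damps each of the other entries
there by `exp (-lam)`. -/
theorem sparseWeight_zero [Fintype Y] {lam : ℝ} (hlam : 0 ≤ lam)
    (hY : Fintype.card Y * Real.exp (-lam) ≤ 1) :
    SparseWeight (zeroRel (Y := Y)) zeroWeight lam 2 := by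
  have h1 : Real.exp (-lam) ≤ 1 := Real.exp_le_one_iff.2 (by linarith)
  constructor
  · rintro (_ | a) <;> rw [Fintype.sum_option]
    · simp [zeroWeight]
    · rw [Finset.sum_eq_single a
        (fun b _ hb => if_neg (by simpa using hb)) (fun h => absurd (mem_univ a) h),
        if_pos (by simp), if_pos (by simp)]
      simp [zeroWeight]
      linarith
  · rintro (_ | a) <;> rw [Fintype.sum_option]
    · simp [zeroWeight]
      linarith
    · rw [Finset.sum_eq_single a
        (fun b _ hb => if_neg (by simpa using hb.symm)) (fun h => absurd (mem_univ a) h),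
        if_neg (by simp), if_pos (by simp)]
      simp [zeroWeight]

/-- The weight is nonzero at a single point, whose term is at most 3, so `b` can be as close to 1 as
`1 + 2 / q`, where `q` is the number of points. -/
theorem momentBound_zero [Fintype Y] {b : ℝ}
    (hb : Fintype.card Y + 3 ≤ (Fintype.card Y + 1) * b) :
    MomentBound (zeroWeight (Y := Y)) 1 b := by
  have e1 : Real.exp (-1) ≤ 1 := Real.exp_le_one_iff.2 (by norm_num)
  have e2 : Real.exp 1 ≤ 3 := Real.exp_one_lt_three.le
  have e3 : (0 : ℝ) ≤ Fintype.card Y := Nat.cast_nonneg _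
  constructor <;> rw [Fintype.sum_option, Fintype.card_option]
  · simp [zeroWeight]
    nlinarith
  · simp [zeroWeight]
    linarith

/-- Row `some a` of `zeroMatrix` has ones at `none` and at `some a`, so conjugation spreads the
corner entry 1 over the whole matrix. -/
theorem zeroMatrix_conj [Fintype Y] (M : Matrix Y Y ℂ) (x y : Option Y) :
    (zeroMatrix Y * optMatrix M * (zeroMatrix Y)ᵀ) x y =
      x.elim 1 fun a => y.elim 1 fun b => M a b + 1 := by
  classical
  rw [Matrix.mul_apply, Fintype.sum_option]
  cases x <;> cases y <;>
    simp [Matrix.mul_apply, Fintype.sum_option, optMatrix, zeroMatrix, add_comm]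

end opt

/-! ### The Fourier matrix at a prime -/

/-- The matrix `φ (x * y)` over `ZMod q` is a product of triangular matrices on the units, with a
zero adjoined, and two matrices sending points to zero. -/
theorem exists_factor_prime {q : ℕ} [Fact q.Prime] {J : Type*} [Fintype J] [DecidableEq J]
    (d : J → ℕ) [∀ j, NeZero (d j)] (e : Additive (ZMod q)ˣ ≃+ ∀ j, ZMod (d j))
    (φ : ZMod q → ℂ) (hφ : φ 0 = 1) :
    ∃ (E : Option (∀ j, ZMod (d j)) ≃ ZMod q)
      (U L L' : Matrix (Option (∀ j, ZMod (d j))) (Option (∀ j, ZMod (d j))) ℂ),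
      (∀ x y, U x y ≠ 0 → optRel (piValRel d) x y) ∧
      (∀ x y, L x y ≠ 0 → optRel (piValRel d) x y) ∧
      (∀ x y, L' x y ≠ 0 → optRel (piValRel d) x y) ∧
      Matrix.of (fun x y => φ (E x * E y)) =
        zeroMatrix _ * U * Lᵀ * (L' * (zeroMatrix _ * U)ᵀ) := by
  classical
  let E₀ : Option (∀ j, ZMod (d j)) → ZMod q :=
    fun x => x.elim 0 fun a => ((e.symm a).toMul : (ZMod q)ˣ)
  have hE : Function.Bijective E₀ := by
    constructor
    · rintro (_ | a) (_ | b) h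
      · rfl
      · exact absurd h.symm (Units.ne_zero _)
      · exact absurd h (Units.ne_zero _)
      · exact congrArg some (e.symm.injective (Additive.toMul.injective (Units.ext h)))
    · intro z
      by_cases hz : z = 0
      · exact ⟨none, hz.symm⟩
      · exact ⟨some (e (Additive.ofMul (Units.mk0 z hz))), by simp [E₀]⟩
  obtain ⟨U, L, L', hU, hL, hL', hM⟩ := exists_triangular_groupMatrix d
    -- The subtracted 1 is what conjugation by `zeroMatrix` puts back; on the row and column of 0
    -- that 1 is already `φ 0`.
    fun a => φ ((e.symm a).toMul : (ZMod q)ˣ) - 1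
  refine ⟨Equiv.ofBijective E₀ hE, optMatrix U, optMatrix L, optMatrix L',
    optMatrix_support hU, optMatrix_support hL, optMatrix_support hL', ?_⟩
  have h1 : zeroMatrix _ * optMatrix U * (optMatrix L)ᵀ *
      (optMatrix L' * (zeroMatrix _ * optMatrix U)ᵀ) =
      zeroMatrix _ * optMatrix (U * Lᵀ * L' * Uᵀ) * (zeroMatrix _)ᵀ := by
    rw [Matrix.transpose_mul, optMatrix_transpose, optMatrix_transpose]
    simp only [← optMatrix_mul, Matrix.mul_assoc]
  rw [h1]
  ext x y
  rw [zeroMatrix_conj, Matrix.of_apply, ← hM]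
  cases x <;> cases y <;> simp [E₀, hφ]

/-- The unit group modulo `q` is a product of cyclic groups of prime power order. -/
theorem exists_units_equiv (q : ℕ) [Fact q.Prime] :
    Nonempty (Additive (ZMod q)ˣ ≃+
      ∀ p : (q - 1).primeFactors, ZMod ((p : ℕ) ^ (q - 1).factorization p)) := by
  have hq : 2 ≤ q := (Fact.out : q.Prime).two_le
  have h1 : Nat.card (ZMod q)ˣ = q - 1 := by
    rw [Nat.card_eq_fintype_card, ZMod.card_units]
  have e1 : Additive (ZMod q)ˣ ≃+ ZMod (q - 1) := by
    rw [← h1]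
    exact (zmodAddCyclicAddEquiv (G := Additive (ZMod q)ˣ) inferInstance).symm
  exact ⟨e1.trans (ZMod.equivPi _ (by omega : q - 1 ≠ 0)).toAddEquiv⟩

theorem card_primeFactors_le_log {n : ℕ} (hn : n ≠ 0) :
    (n.primeFactors.card : ℝ) * Real.log 2 ≤ Real.log n := by
  have h1 : 2 ^ n.primeFactors.card ≤ n := by
    calc 2 ^ n.primeFactors.card ≤ ∏ p ∈ n.primeFactors, p :=
          Finset.pow_card_le_prod _ _ _ fun p hp => (Nat.prime_of_mem_primeFactors hp).two_le
      _ ≤ n := Nat.le_of_dvd (Nat.pos_of_ne_zero hn) (Nat.prod_primeFactors_dvd n)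
  rw [← Real.log_pow]
  exact Real.log_le_log (by positivity) (by exact_mod_cast h1)

/-! ### The Fourier matrix of squarefree order -/

theorem dftMatrix_apply {N : ℕ} [NeZero N] (j k : Fin N) :
    dftMatrix N j k = ZMod.stdAddChar ((j : ℕ) * (k : ℕ) : ZMod N) := by
  have := ZMod.stdAddChar_coe (N := N) ((j : ℕ) * (k : ℕ) : ℤ)
  push_cast at this
  rw [this, dftMatrix]
  congr 1
  ring

/-- An additive character of a finite product is the product of its restrictions. -/
theorem addChar_pi_eq_prod {ι : Type*} [Fintype ι] [DecidableEq ι] {A : ι → Type*}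
    [∀ i, AddCommGroup (A i)] (ψ : AddChar (∀ i, A i) ℂ) (x : ∀ i, A i) :
    ψ x = ∏ i, ψ (Pi.single i (x i)) := by
  conv_lhs => rw [← Finset.univ_sum_single x]
  exact map_prod ψ.toMonoidHom (fun i => Multiplicative.ofAdd (Pi.single i (x i))) univ

/-- Up to permutations, the Fourier matrix of squarefree order is a Kronecker product over the
prime factors. -/
theorem exists_dft_eq_kron (Q : Finset ℕ) (hQ : ∀ q ∈ Q, q.Prime) :
    ∃ (E : Fin (∏ q ∈ Q, q) ≃ ∀ q : Q, ZMod q) (φ : ∀ q : Q, ZMod q → ℂ), (∀ q, φ q 0 = 1) ∧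
      dftMatrix (∏ q ∈ Q, q) =
        (kron fun q => Matrix.of fun x y => φ q (x * y)).submatrix E E := by
  classical
  set N := ∏ q ∈ Q, q with hN
  have hN0 : N ≠ 0 := Finset.prod_ne_zero_iff.2 fun q hq => (hQ q hq).ne_zero
  have : NeZero N := ⟨hN0⟩
  have hN' : N = ∏ q : Q, (q : ℕ) := (Finset.prod_coe_sort Q fun q => q).symm
  -- A ring isomorphism is needed: the entry is a character of the product `j * k`, which must
  -- become a coordinatewise product.
  let c : ZMod N ≃+* ∀ q : Q, ZMod q := (ZMod.ringEquivCongr hN').trans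
    (ZMod.prodEquivPi (fun q : Q => (q : ℕ)) fun q q' hqq' =>
      (Nat.coprime_primes (hQ q q.2) (hQ q' q'.2)).2 fun h => hqq' (Subtype.ext h))
  let ψ : AddChar (∀ q : Q, ZMod q) ℂ :=
    (ZMod.stdAddChar (N := N)).compAddMonoidHom c.symm.toAddMonoidHom
  refine ⟨(ZMod.finEquiv N).toEquiv.trans c.toEquiv, fun q x => ψ (Pi.single q x), fun q => ?_, ?_⟩
  · simp
  · ext j k
    rw [dftMatrix_apply, Matrix.submatrix_apply, kron, Matrix.of_apply]
    have h1 : ∀ j : Fin N, ZMod.finEquiv N j = ((j : ℕ) : ZMod N) := by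
      obtain ⟨n, hn⟩ := Nat.exists_eq_succ_of_ne_zero hN0
      clear_value N
      subst hn
      intro j
      exact (Fin.cast_val_eq_self j).symm
    have h2 := addChar_pi_eq_prod ψ (c (ZMod.finEquiv N j) * c (ZMod.finEquiv N k))
    rw [← map_mul, h1, h1] at h2
    have h3 : ψ (c ((j : ℕ) * (k : ℕ))) = ZMod.stdAddChar ((j : ℕ) * (k : ℕ) : ZMod N) := by
      simp [ψ]
    rw [← h3, h2]
    refine Finset.prod_congr rfl fun q _ => ?_
    simp [h1]

/-! ### Quantitative splittings -/

theorem SparseWeight.mono {X : Type*} [Fintype X] {R : X → X → Prop} {h : X → ℝ} {lam c c' : ℝ}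
    (H : SparseWeight R h lam c) (hc : c ≤ c') : SparseWeight R h lam c' :=
  ⟨fun x => (H.1 x).trans hc, fun y => (H.2 y).trans hc⟩

theorem isRegularSplit_kron_of_weight {ι F : Type*} [Fintype ι] [DecidableEq ι] [Field F]
    {X : ι → Type*} [∀ i, Fintype (X i)] {T : ∀ i, Matrix (X i) (X i) F}
    {R : ∀ i, X i → X i → Prop} (hT : ∀ i x y, T i x y ≠ 0 → R i x y) {h : ∀ i, X i → ℝ}
    {lam mu c b : ℝ} (D : ℝ) (hlam : 0 ≤ lam) (hmu : 0 ≤ mu)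
    (hR : ∀ i, SparseWeight (R i) (h i) lam (Real.exp c))
    (hb : ∀ i, MomentBound (h i) mu (Real.exp b)) :
    IsRegularSplit (kron T)
      (2 * (Fintype.card (∀ i, X i) * Real.exp (Fintype.card ι * b - mu * D)))
      ⌊Real.exp (2 * lam * D + Fintype.card ι * c)⌋₊ := by
  have h1 := SparseWeight.pi hR
  have h2 := MomentBound.pi hb
  rw [Finset.prod_const, ← Real.exp_nat_mul, Finset.card_univ] at h1 h2
  have h3 := isRegularSplit_of_weight (D := D)
    (fun x y hxy => kron_support (R := R) hT x y hxy) hlam hmu h1 h2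
  rw [← Real.exp_add, mul_assoc, ← Real.exp_add, ← sub_eq_add_neg] at h3
  exact h3

theorem isRegularSplit_kron_conj {ι : Type*} [Fintype ι] [DecidableEq ι]
    {X : ι → Type*} [∀ i, Fintype (X i)]
    {P U L L' : ∀ i, Matrix (X i) (X i) ℂ} {r₀ r₁ : ℝ} {s₀ s₁ : ℕ}
    (hP : IsRegularSplit (kron P) r₀ s₀) (hU : IsRegularSplit (kron U) r₁ s₁)
    (hL : IsRegularSplit (kron L) r₁ s₁) (hL' : IsRegularSplit (kron L') r₁ s₁) :
    IsRegularSplit (kron fun i => P i * U i * (L i)ᵀ * (L' i * (P i * U i)ᵀ))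
      (2 * r₀ + 4 * r₁) (s₀ * s₁ * s₁ * (s₁ * (s₀ * s₁))) := by
  have h1 := (hP.mul hU).mul hL.transpose |>.mul (hL'.mul (hP.mul hU).transpose)
  simp only [kron_transpose, kron_mul] at h1
  exact h1.mono (by linarith)

theorem isRegularSplit_kron_units {ι : Type*} [Fintype ι] [DecidableEq ι] {J : ι → Type*}
    [∀ i, Fintype (J i)] [∀ i, DecidableEq (J i)] (d : ∀ i, J i → ℕ) [∀ i j, NeZero (d i j)]
    {U L L' : ∀ i, Matrix (Option (∀ j, ZMod (d i j))) (Option (∀ j, ZMod (d i j))) ℂ}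
    (hU : ∀ i x y, U i x y ≠ 0 → optRel (piValRel (d i)) x y)
    (hL : ∀ i x y, L i x y ≠ 0 → optRel (piValRel (d i)) x y)
    (hL' : ∀ i x y, L' i x y ≠ 0 → optRel (piValRel (d i)) x y)
    {X y Dm ν lam mu : ℝ} (D k : ℝ) (hy : 0 < y) (hX : 1 ≤ X) (hν : 0 ≤ ν)
    (hlam : 0 ≤ lam) (hlam' : Real.exp (-lam) ≤ 1 / 2) (hmu : 0 ≤ mu)
    (hyq : ∀ i, y ≤ (Fintype.card (∀ j, ZMod (d i j)) : ℝ) + 1)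
    (hqX : ∀ i, (Fintype.card (∀ j, ZMod (d i j)) : ℝ) + 1 ≤ X)
    (hd : ∀ i j, (d i j : ℝ) ≤ Dm) (hJ : ∀ i, (Fintype.card (J i) : ℝ) ≤ ν) :
    IsRegularSplit (kron fun i => zeroMatrix _ * U i * (L i)ᵀ * (L' i * (zeroMatrix _ * U i)ᵀ))
      (2 * (2 * (Fintype.card (∀ i, Option (∀ j, ZMod (d i j))) *
          Real.exp (Fintype.card ι * (2 / y) - 1 * k))) +
        4 * (2 * (Fintype.card (∀ i, Option (∀ j, ZMod (d i j))) *
          Real.exp (Fintype.card ι * (ν * (mu ^ 2 * Dm ^ 2 / 8)) - mu * D))))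
      (⌊Real.exp (2 * Real.log X * k + Fintype.card ι * 1)⌋₊ *
          ⌊Real.exp (2 * lam * D + Fintype.card ι * (2 * Real.exp (-lam) * ν))⌋₊ *
          ⌊Real.exp (2 * lam * D + Fintype.card ι * (2 * Real.exp (-lam) * ν))⌋₊ *
        (⌊Real.exp (2 * lam * D + Fintype.card ι * (2 * Real.exp (-lam) * ν))⌋₊ *
          (⌊Real.exp (2 * Real.log X * k + Fintype.card ι * 1)⌋₊ *
            ⌊Real.exp (2 * lam * D + Fintype.card ι * (2 * Real.exp (-lam) * ν))⌋₊))) := by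
  have hexp := Real.exp_pos (-lam)
  have tri : ∀ T : ∀ i, Matrix (Option (∀ j, ZMod (d i j))) (Option (∀ j, ZMod (d i j))) ℂ,
      (∀ i x y, T i x y ≠ 0 → optRel (piValRel (d i)) x y) → IsRegularSplit (kron T)
      (2 * (Fintype.card (∀ i, Option (∀ j, ZMod (d i j))) *
          Real.exp (Fintype.card ι * (ν * (mu ^ 2 * Dm ^ 2 / 8)) - mu * D)))
      ⌊Real.exp (2 * lam * D + Fintype.card ι * (2 * Real.exp (-lam) * ν))⌋₊ := by
    intro T hT
    refine isRegularSplit_kron_of_weight hT (h := fun i => optWeight (piValWeight (d i)))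
      D hlam hmu (fun i => ?_) fun i => ?_
    · refine ((sparseWeight_piVal (d i) hlam').mono (Real.exp_le_exp.2 ?_)).opt
        (Real.one_le_exp (by positivity))
      exact mul_le_mul_of_nonneg_left (hJ i) (by positivity)
    · refine ((momentBound_piVal (d i) (hd i) mu).mono (Real.exp_le_exp.2 ?_)).opt
        (Real.one_le_exp (by positivity))
      exact mul_le_mul_of_nonneg_right (hJ i) (by positivity)
  refine isRegularSplit_kron_conj ?_ (tri U hU) (tri L hL) (tri L' hL')
  refine isRegularSplit_kron_of_weight (R := fun i => zeroRel) (h := fun i => zeroWeight)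
    (fun i x y h => zeroMatrix_support x y h) k (Real.log_nonneg hX) zero_le_one
    (fun i => ?_) fun i => ?_
  · refine (sparseWeight_zero (Real.log_nonneg hX) ?_).mono
      (by have := Real.add_one_le_exp 1; linarith)
    rw [Real.exp_neg, Real.exp_log (by linarith), ← div_eq_mul_inv, div_le_one (by linarith)]
    linarith [hqX i]
  · apply momentBound_zero
    have h1 := Real.add_one_le_exp (2 / y)
    have h2 : (0 : ℝ) ≤ (Fintype.card (∀ j, ZMod (d i j)) : ℝ) + 1 := by positivity
    have h3 := mul_le_mul_of_nonneg_left h1 h2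
    have h4 : 2 ≤ ((Fintype.card (∀ j, ZMod (d i j)) : ℝ) + 1) * (2 / y) := by
      rw [mul_div_assoc', le_div_iff₀ hy]
      nlinarith [hyq i]
    linarith

/-- The Fourier matrix of squarefree order `N`, where the numbers `q - 1` for `q ∣ N` have only
small prime power divisors. -/
theorem isRegularSplit_dft (Q : Finset ℕ) (hQ : ∀ q ∈ Q, q.Prime)
    {X y Dm lam mu : ℝ} (D k : ℝ) (hy : 0 < y) (hX : 1 ≤ X)
    (hlam : 0 ≤ lam) (hlam' : Real.exp (-lam) ≤ 1 / 2) (hmu : 0 ≤ mu)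
    (hyq : ∀ q ∈ Q, y ≤ (q : ℝ)) (hqX : ∀ q ∈ Q, (q : ℝ) ≤ X)
    (hd : ∀ q ∈ Q, ∀ t : ℕ, IsPrimePow t → t ∣ q - 1 → (t : ℝ) ≤ Dm) :
    ∃ s : ℕ, (s : ℝ) ≤ Real.exp (2 * (2 * Real.log X * k + Q.card) +
        4 * (2 * lam * D + Q.card * (4 * Real.exp (-lam) * Real.log X))) ∧
      IsRegularSplit (dftMatrix (∏ q ∈ Q, q))
        (((∏ q ∈ Q, q : ℕ) : ℝ) * (4 * Real.exp (Q.card * (2 / y) - k) +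
          8 * Real.exp (Q.card * Real.log X * (mu ^ 2 * Dm ^ 2 / 4) - mu * D))) s := by
  classical
  obtain ⟨E, φ, hφ, hM⟩ := exists_dft_eq_kron Q hQ
  have hfact : ∀ q : Q, Fact (q : ℕ).Prime := fun q => ⟨hQ q q.2⟩
  let J : Q → Type := fun q => ((q : ℕ) - 1).primeFactors
  let d : ∀ q : Q, J q → ℕ := fun q p => (p : ℕ) ^ ((q : ℕ) - 1).factorization p
  have hne : ∀ (q : Q) (p : J q), NeZero (d q p) := fun q p =>
    ⟨pow_ne_zero _ (Nat.prime_of_mem_primeFactors p.2).ne_zero⟩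
  have hfac := fun q : Q => exists_factor_prime (d q) (exists_units_equiv (q : ℕ)).some (φ q) (hφ q)
  choose e U L L' hU hL hL' hP using hfac
  have hcard : ∀ q : Q, Fintype.card (∀ j, ZMod (d q j)) + 1 = (q : ℕ) := fun q => by
    rw [← Fintype.card_option, Fintype.card_congr (e q), ZMod.card]
  have hcard' : ∀ q : Q, (Fintype.card (∀ j, ZMod (d q j)) : ℝ) + 1 = (q : ℕ) := fun q => by
    exact_mod_cast hcard q
  have hJ : ∀ q : Q, (Fintype.card (J q) : ℝ) ≤ 2 * Real.log X := by
    intro q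
    have hq := (hQ q q.2).two_le
    have h1 := card_primeFactors_le_log (n := (q : ℕ) - 1) (by omega)
    have h2 : Real.log ((q : ℕ) - 1 : ℕ) ≤ Real.log X := by
      refine Real.log_le_log (by exact_mod_cast (by omega : 0 < (q : ℕ) - 1)) ?_
      refine le_trans ?_ (hqX q q.2)
      exact_mod_cast Nat.sub_le _ _
    -- This turns the bound `log X / log 2` on the number of prime factors into `2 * log X`.
    have h3 : (1 : ℝ) / 2 ≤ Real.log 2 := by have := Real.log_two_gt_d9; linarith
    have h4 : Fintype.card (J q) = ((q : ℕ) - 1).primeFactors.card := Fintype.card_coe _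
    rw [h4]
    have h5 : (0 : ℝ) ≤ ((q : ℕ) - 1).primeFactors.card := Nat.cast_nonneg _
    nlinarith
  have hdq : ∀ (q : Q) (p : J q), (d q p : ℝ) ≤ Dm := by
    intro q p
    have hp := Nat.prime_of_mem_primeFactors p.2
    refine hd q q.2 _ (hp.isPrimePow.pow ?_) (Nat.ordProj_dvd _ _)
    exact (hp.factorization_pos_of_dvd (Nat.sub_ne_zero_of_lt (hQ q q.2).one_lt)
      (Nat.dvd_of_mem_primeFactors p.2)).ne'
  have main := isRegularSplit_kron_units d hU hL hL' D k hy hX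
    (mul_nonneg zero_le_two (Real.log_nonneg hX)) hlam hlam' hmu
    (fun q => by rw [hcard']; exact hyq q q.2) (fun q => by rw [hcard']; exact hqX q q.2) hdq hJ
  have hN : Fintype.card (∀ q : Q, Option (∀ j, ZMod (d q j))) = ∏ q ∈ Q, q := by
    rw [Fintype.card_pi, ← Finset.prod_coe_sort Q fun q => q]
    exact Finset.prod_congr rfl fun q _ => by rw [Fintype.card_option, hcard]
  have hdft : dftMatrix (∏ q ∈ Q, q) = (kron fun q => zeroMatrix _ * U q * (L q)ᵀ *
      (L' q * (zeroMatrix _ * U q)ᵀ)).submatrix (E.trans (Equiv.piCongrRight fun q => (e q).symm))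
        (E.trans (Equiv.piCongrRight fun q => (e q).symm)) := by
    rw [hM]
    ext a b
    simp only [Matrix.submatrix_apply, kron, Matrix.of_apply, ← hP]
    refine Finset.prod_congr rfl fun q _ => ?_
    simp
  refine ⟨_, ?_, hdft ▸ (main.submatrix _ _).mono (le_of_eq ?_)⟩
  · push_cast
    have h0 : ∀ a : ℝ, ((⌊Real.exp a⌋₊ : ℕ) : ℝ) ≤ Real.exp a := fun a =>
      Nat.floor_le (Real.exp_pos a).le
    have h1 : ∀ a b : ℝ, (⌊Real.exp a⌋₊ : ℝ) * ⌊Real.exp b⌋₊ * ⌊Real.exp b⌋₊ *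
        (⌊Real.exp b⌋₊ * (⌊Real.exp a⌋₊ * ⌊Real.exp b⌋₊)) ≤ Real.exp (2 * a + 4 * b) := by
      intro a b
      have : Real.exp (2 * a + 4 * b) = Real.exp a * Real.exp b * Real.exp b *
          (Real.exp b * (Real.exp a * Real.exp b)) := by
        simp only [← Real.exp_add]
        congr 1
        ring
      rw [this]
      have ha := h0 a
      have hb := h0 b
      gcongr
    refine (h1 _ _).trans (le_of_eq ?_)
    rw [Fintype.card_coe]
    congr 1
    ring
  · rw [hN, Fintype.card_coe, one_mul]
    rw [show (Q.card : ℝ) * (2 * Real.log X * (mu ^ 2 * Dm ^ 2 / 8)) - mu * D =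
      Q.card * Real.log X * (mu ^ 2 * Dm ^ 2 / 4) - mu * D by ring]
    ring

end DFTRigidity

namespace DFTRigidity

open Finset Filter

/-! ### Asymptotics -/

theorem eventually_log_rpow_le (r : ℝ) {s : ℝ} (hs : 0 < s) :
    ∀ᶠ x : ℝ in atTop, Real.log x ^ r ≤ x ^ s := by
  filter_upwards [(isLittleO_log_rpow_rpow_atTop r hs).bound one_pos, eventually_ge_atTop 0]
    with x hx hx0
  rw [one_mul, Real.norm_of_nonneg (Real.rpow_nonneg hx0 s)] at hx
  exact (le_abs_self _).trans hx

theorem mul_log_le_log_prod {Q : Finset ℕ} {y : ℝ} (hy : 0 < y) (h : ∀ q ∈ Q, y ≤ (q : ℝ)) :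
    Q.card * Real.log y ≤ Real.log ((∏ q ∈ Q, q : ℕ) : ℝ) := by
  rw [Nat.cast_prod, Real.log_prod fun q hq => (hy.trans_le (h q hq)).ne', ← nsmul_eq_mul]
  exact Finset.card_nsmul_le_sum _ _ _ fun q hq => Real.log_le_log hy (h q hq)

theorem log_prod_le_mul_log {Q : Finset ℕ} {X : ℝ} (h0 : ∀ q ∈ Q, 0 < q)
    (h : ∀ q ∈ Q, (q : ℝ) ≤ X) :
    Real.log ((∏ q ∈ Q, q : ℕ) : ℝ) ≤ Q.card * Real.log X := by
  have h0' : ∀ q ∈ Q, (0 : ℝ) < q := fun q hq => Nat.cast_pos.2 (h0 q hq)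
  rw [Nat.cast_prod, Real.log_prod fun q hq => (h0' q hq).ne', ← nsmul_eq_mul]
  exact Finset.sum_le_card_nsmul _ _ _ fun q hq => Real.log_le_log (h0' q hq) (h q hq)

theorem regularRigidity_le {m n F : Type*} [Fintype n] [Field F] {M : Matrix m n F} {r r' b : ℝ}
    {s : ℕ} (h : IsRegularSplit M r s) (hr : r ≤ r') (hs : (s : ℝ) ≤ b) :
    (regularRigidity M r' : ℝ) ≤ b :=
  le_trans (Nat.cast_le.2 (Nat.sInf_le (h.mono hr))) hs

/-- The rank estimate: with `k = x ^ 0.38`, both terms are dominated. -/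
theorem rank_estimate {x l t δ ε logN : ℝ} (hx : 1 ≤ x) (hε : 0 < ε) (hε' : ε < 0.01)
    (hY : 6 ≤ x ^ (0.01 : ℝ)) (hδ : 1 ≤ δ ^ 2 * x ^ (0.01 : ℝ)) (hl : x ^ (0.99 : ℝ) ≤ l)
    (hlog : 1 ≤ Real.log x) (ht : t ≤ 2) (h0 : 0 ≤ logN) (hN : logN ≤ x ^ (1.01 : ℝ)) :
    4 * Real.exp (t - x ^ (0.38 : ℝ)) +
      8 * Real.exp (-(δ ^ 2 * (l * Real.log x) / x ^ (0.6 : ℝ))) ≤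
      (Real.exp (ε ^ 6 * logN ^ (0.36 : ℝ)))⁻¹ := by
  have hx0 : 0 < x := by linarith
  have h37 : 1 ≤ x ^ (0.37 : ℝ) := Real.one_le_rpow hx (by norm_num)
  have h38 : x ^ (0.38 : ℝ) = x ^ (0.37 : ℝ) * x ^ (0.01 : ℝ) := by
    rw [← Real.rpow_add hx0]; norm_num
  -- Since `0.38 + 0.6 = 0.98`, there is a spare `x ^ 0.01` below `l ≥ x ^ 0.99`, and it absorbs `δ
  -- ^ 2`.
  have e1 : x ^ (0.38 : ℝ) ≤ δ ^ 2 * (l * Real.log x) / x ^ (0.6 : ℝ) := by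
    have hp : 0 < x ^ (0.6 : ℝ) := Real.rpow_pos_of_pos hx0 _
    rw [le_div_iff₀ hp, ← Real.rpow_add hx0]
    have h98 : x ^ (0.38 + 0.6 : ℝ) * (δ ^ 2 * x ^ (0.01 : ℝ)) = δ ^ 2 * x ^ (0.99 : ℝ) := by
      rw [mul_left_comm, ← Real.rpow_add hx0]; norm_num
    have hp2 : 0 < x ^ (0.38 + 0.6 : ℝ) := Real.rpow_pos_of_pos hx0 _
    have h1 : x ^ (0.38 + 0.6 : ℝ) ≤ δ ^ 2 * x ^ (0.99 : ℝ) := by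
      rw [← h98]; exact le_mul_of_one_le_right hp2.le hδ
    refine h1.trans (mul_le_mul_of_nonneg_left ?_ (sq_nonneg δ))
    have : 0 < x ^ (0.99 : ℝ) := Real.rpow_pos_of_pos hx0 _
    exact hl.trans (le_mul_of_one_le_right (by linarith) hlog)
  have e2 : Real.exp (-(δ ^ 2 * (l * Real.log x) / x ^ (0.6 : ℝ))) ≤
      Real.exp (2 - x ^ (0.38 : ℝ)) := Real.exp_le_exp.2 (by linarith)
  have e3 : Real.exp (t - x ^ (0.38 : ℝ)) ≤ Real.exp (2 - x ^ (0.38 : ℝ)) :=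
    Real.exp_le_exp.2 (by linarith)
  have e4 : (12 : ℝ) ≤ Real.exp 3 := by
    have h1 : Real.exp 3 = Real.exp 1 ^ 3 := by rw [← Real.exp_nat_mul]; norm_num
    rw [h1]
    have h2 := Real.exp_one_gt_d9
    have h3 : (2.5 : ℝ) ^ 3 ≤ Real.exp 1 ^ 3 := pow_le_pow_left₀ (by norm_num) (by linarith) 3
    norm_num at h3 ⊢
    linarith
  have e5 : 12 * Real.exp (2 - x ^ (0.38 : ℝ)) ≤ Real.exp (-x ^ (0.37 : ℝ)) := by
    refine (mul_le_mul_of_nonneg_right e4 (Real.exp_pos _).le).trans ?_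
    rw [← Real.exp_add]
    exact Real.exp_le_exp.2 (by rw [h38]; nlinarith)
  have e6 : ε ^ 6 * logN ^ (0.36 : ℝ) ≤ x ^ (0.37 : ℝ) := by
    have h1 : logN ^ (0.36 : ℝ) ≤ x ^ (0.37 : ℝ) := by
      refine (Real.rpow_le_rpow h0 hN (by norm_num)).trans ?_
      rw [← Real.rpow_mul hx0.le]
      exact Real.rpow_le_rpow_of_exponent_le hx (by norm_num)
    have h2 : ε ^ 6 ≤ 1 := pow_le_one₀ hε.le (by linarith)
    exact (mul_le_of_le_one_left (Real.rpow_nonneg h0 _) h2).trans h1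
  rw [← Real.exp_neg]
  have e7 : Real.exp (-x ^ (0.37 : ℝ)) ≤ Real.exp (-(ε ^ 6 * logN ^ (0.36 : ℝ))) :=
    Real.exp_le_exp.2 (by linarith)
  linarith

end DFTRigidity

open DFTRigidity Filter in
theorem mainTheorem7 (C₀ ε : ℝ) (hε : 0 < ε) (hε' : ε < 0.01) :
    ∃ x₀ : ℝ, ∀ x : ℝ, x₀ ≤ x → ∀ l N : ℕ,
      x / Real.log x ^ (C₀ + 100) ≤ (l : ℝ) →
      (l : ℝ) ≤ x / Real.log x ^ (C₀ + 10) →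
      DFTRigidity.IsFactorable C₀ l 0.3 x N →
      (DFTRigidity.regularRigidity (DFTRigidity.dftMatrix N)
          ((N : ℝ) / Real.exp (ε ^ 6 * Real.log (N : ℝ) ^ (0.36 : ℝ))) : ℝ)
        ≤ (N : ℝ) ^ (7 * ε) := by
  -- With `exp (-lam) = ε / 32` and `δ * lam = ε / 16`, the two parts of the triangular sparsity
  -- exponent, `8 δ lam n L` and `16 exp (-lam) n L`, are each `ε / 2 * n L`.
  set lam := Real.log (32 / ε) with hlam
  have hlam_pos : 0 < lam := Real.log_pos (by rw [lt_div_iff₀ hε]; linarith)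
  have hexp : Real.exp (-lam) = ε / 32 := by
    rw [hlam, Real.exp_neg, Real.exp_log (by positivity), inv_div]
  set δ := ε / (16 * lam) with hδ
  have hδ_pos : 0 < δ := by positivity
  have hδlam : δ * lam = ε / 16 := by rw [hδ]; field_simp
  obtain ⟨x₀, hx₀⟩ := eventually_atTop.1 <|
    (eventually_log_rpow_le (C₀ + 100) (s := 0.01) (by norm_num)).and <|
    (eventually_log_rpow_le C₀ (s := 1 / 2) (by norm_num)).and <|
    (eventually_log_rpow_le (1 - (C₀ + 10)) (s := 0.01) (by norm_num)).and <|
    ((tendsto_rpow_atTop (y := (0.01 : ℝ)) (by norm_num)).eventually_ge_atTop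
      (max 6 (max (1 / δ ^ 2) (4 / ε)))).and <|
    (Real.tendsto_log_atTop.eventually_ge_atTop (max 1 (2 / ε))).and <|
    eventually_ge_atTop 1
  refine ⟨x₀, fun x hx l N hl hl' hN => ?_⟩
  obtain ⟨f1, f2, f3, f4, f5, hx1⟩ := hx₀ x hx
  obtain ⟨Q, hQl, hgood, rfl⟩ := hN
  subst hQl
  rw [max_le_iff, max_le_iff, div_le_iff₀ (by positivity), div_le_iff₀ hε] at f4
  rw [max_le_iff, div_le_iff₀ hε] at f5
  obtain ⟨hY6, hYδ, hYε⟩ := f4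
  obtain ⟨hlog, hlogε⟩ := f5
  have hx0 : 0 < x := by linarith
  have hlog0 : 0 < Real.log x := by linarith
  have hC : 0 < Real.log x ^ C₀ := Real.rpow_pos_of_pos hlog0 _
  set L := Real.log x with hL
  set n : ℝ := (Q.card : ℝ) with hn
  have hn99 : x ^ (0.99 : ℝ) ≤ n := by
    refine le_trans ?_ hl
    rw [le_div_iff₀ (Real.rpow_pos_of_pos hlog0 _)]
    refine (mul_le_mul_of_nonneg_left f1 (Real.rpow_nonneg hx0.le _)).trans (le_of_eq ?_)
    rw [← Real.rpow_add hx0]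
    norm_num
  have hn0 : 0 < n := (Real.rpow_pos_of_pos hx0 _).trans_le hn99
  have hnL : n * L ≤ x ^ (1.01 : ℝ) := by
    refine (mul_le_mul_of_nonneg_right hl' hlog0.le).trans ?_
    have h1 : x / L ^ (C₀ + 10) * L = x * L ^ (1 - (C₀ + 10)) := by
      rw [Real.rpow_sub hlog0, Real.rpow_one]; ring
    rw [h1]
    refine (mul_le_mul_of_nonneg_left f3 hx0.le).trans (le_of_eq ?_)
    rw [← Real.rpow_one_add' hx0.le (by norm_num)]
    norm_num
  have hy : 0 < x / L ^ C₀ := by positivity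
  have hprime : ∀ q ∈ Q, q.Prime := fun q hq => (hgood q hq).1
  have hyq : ∀ q ∈ Q, x / L ^ C₀ ≤ (q : ℝ) := fun q hq => (hgood q hq).2.1
  have hqx : ∀ q ∈ Q, (q : ℝ) ≤ x := fun q hq => (hgood q hq).2.2.1
  -- There are fewer primes than the size of the smallest one allowed, so a random point has a
  -- bounded expected number of zero coordinates.
  have hratio : n * (2 / (x / L ^ C₀)) ≤ 2 := by
    have h1 : n ≤ x / L ^ C₀ := by
      refine hl'.trans (div_le_div_of_nonneg_left hx0.le hC ?_)
      exact Real.rpow_le_rpow_of_exponent_le hlog (by linarith)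
    rw [mul_div_assoc', div_le_iff₀ hy]
    linarith
  have hlogN : n * L / 2 ≤ Real.log ((∏ q ∈ Q, q : ℕ) : ℝ) := by
    refine le_trans ?_ (mul_log_le_log_prod hy hyq)
    have h1 : x ^ (1 / 2 : ℝ) ≤ x / L ^ C₀ := by
      rw [le_div_iff₀ hC]
      refine (mul_le_mul_of_nonneg_left f2 (Real.rpow_nonneg hx0.le _)).trans (le_of_eq ?_)
      rw [← Real.rpow_add hx0]
      norm_num
    have h2 := Real.log_le_log (Real.rpow_pos_of_pos hx0 _) h1
    rw [Real.log_rpow hx0] at h2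
    have h3 := mul_le_mul_of_nonneg_left h2 hn0.le
    linarith
  have hlogN' : Real.log ((∏ q ∈ Q, q : ℕ) : ℝ) ≤ x ^ (1.01 : ℝ) :=
    (log_prod_le_mul_log (fun q hq => (hprime q hq).pos) hqx).trans hnL
  have hNpos : (0 : ℝ) < ((∏ q ∈ Q, q : ℕ) : ℝ) :=
    Nat.cast_pos.2 (Finset.prod_pos fun q hq => (hprime q hq).pos)
  have hDm : 0 < x ^ (0.3 : ℝ) := Real.rpow_pos_of_pos hx0 _
  -- This `mu` minimises the Chernoff exponent `n L mu² Dm² / 4 - mu D` at `D = δ n L`; the minimum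
  -- is `-δ² n L / Dm²`.
  obtain ⟨s, hs, hsplit⟩ := isRegularSplit_dft Q hprime (Dm := x ^ (0.3 : ℝ)) (lam := lam)
    (mu := 2 * δ / (x ^ (0.3 : ℝ)) ^ 2) (δ * (n * L)) (x ^ (0.38 : ℝ)) hy hx1 hlam_pos.le
    (by rw [hexp]; linarith) (by positivity) hyq hqx fun q hq => (hgood q hq).2.2.2
  refine regularRigidity_le hsplit ?_ (hs.trans ?_)
  · rw [div_eq_mul_inv]
    refine mul_le_mul_of_nonneg_left ?_ hNpos.le
    have h6 : (x ^ (0.3 : ℝ)) ^ 2 = x ^ (0.6 : ℝ) := by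
      rw [← Real.rpow_natCast, ← Real.rpow_mul hx0.le]; norm_num
    have h1 : n * L * ((2 * δ / (x ^ (0.3 : ℝ)) ^ 2) ^ 2 * (x ^ (0.3 : ℝ)) ^ 2 / 4) -
        2 * δ / (x ^ (0.3 : ℝ)) ^ 2 * (δ * (n * L)) = -(δ ^ 2 * (n * L) / x ^ (0.6 : ℝ)) := by
      rw [← h6]
      field_simp
      ring
    rw [h1]
    exact rank_estimate hx1 hε hε' hY6 (by linarith) hn99 hlog hratio
      (le_trans (by positivity) hlogN) hlogN'
  · rw [Real.rpow_def_of_pos hNpos]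
    refine Real.exp_le_exp.2 ?_
    -- The zero factors contribute at most `2 ε n L` to the exponent and the triangular ones `ε n
    -- L`; the total `3 ε n L` fits below `7 ε log N` because `log N ≥ n L / 2`.
    have h1 : 4 * x ^ (0.38 : ℝ) ≤ ε * n := by
      have h2 : x ^ (0.38 : ℝ) * x ^ (0.01 : ℝ) ≤ n := by
        rw [← Real.rpow_add hx0]
        exact (Real.rpow_le_rpow_of_exponent_le hx1 (by norm_num)).trans hn99
      have h3 : 0 < x ^ (0.38 : ℝ) := Real.rpow_pos_of_pos hx0 _
      nlinarith
    have h2 := mul_le_mul_of_nonneg_right h1 hlog0.le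
    have h3 := mul_le_mul_of_nonneg_left hlogε hn0.le
    have h4 : 2 * (2 * L * x ^ (0.38 : ℝ) + n) +
        4 * (2 * lam * (δ * (n * L)) + n * (4 * Real.exp (-lam) * L)) =
        4 * x ^ (0.38 : ℝ) * L + n * 2 + 8 * (δ * lam) * (n * L) + n * L * (ε / 2) := by
      rw [hexp]; ring
    rw [h4, hδlam]
    have h5 := mul_le_mul_of_nonneg_right hlogN (by positivity : 0 ≤ 7 * ε)
    have h6 : 0 < n * L * ε := by positivity
    linarith
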